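/- **Setting.** A signature is a set of operators with ranks; $\mathsf T(\Sigma)$ is the set of closed terms (processes) over a signature $\Sigma$, and $\Delta(\mathsf T(\Sigma))$ the set of discrete probability distributions on it. A PGSOS specification $P=(\Sigma,A,R)$ consists of a signature $\Sigma$, a set $A$ of actions and a set $R$ of rules $$\frac{\{x_i\xrightarrow{a_{i,k}}\mu_{i,k}\}_{1\le i\le n,\,k\in K_i}\qquad\{x_i\not\xrightarrow{b_{i,l}}\}_{1\le i\le n,\,l\in L_i}}{f(x_1,\dots,x_n)\xrightarrow{a}\theta}$$ with $K_i,L_i$ finite, $x_i$ and $\mu_{i,k}$ pairwise different state and distribution variables, and $\theta$ a distribution term in these variables (built from distribution variables, Dirac distributions $\delta(t)$ of state terms $t$, convex combinations with positive weights, and products $f(\theta_1,\dots,\theta_m)$ with $f\in\Sigma$), such that for all $f\in\Sigma$ and $a\in A$ only finitely many rules have source operator $f$ and conclusion label $a$. It induces a unique supported transition relation ${\to}\subseteq\mathsf T(\Sigma)\times A\times\Delta(\mathsf T(\Sigma))$, i.e. one that contains exactly the transitions that are conclusions of closed rule instances whose premises hold. For a function $d\colon\mathsf T(\Sigma)^2\to[0,1]$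 let $\mathbf K(d)(\pi,\pi')=\inf_\omega\sum_{t,t'}d(t,t')\,\omega(t,t')$, with $\omega$ ranging over the distributions on $\mathsf T(\Sigma)^2$ with marginals $\pi,\pi'$. For $\lambda\in(0,1]$, a pseudometric $d\colon\mathsf T(\Sigma)^2\to[0,1]$ is a $\lambda$-bisimulation metric if, whenever $d(s,t)<1$ and $s\xrightarrow{a}\pi$, there is $t\xrightarrow{a}\pi'$ with $\lambda\,\mathbf K(d)(\pi,\pi')\le d(s,t)$. The $\lambda$-bisimilarity metric $\mathbf d$ is the smallest $\lambda$-bisimulation metric in the pointwise order. An operator $f\in\Sigma$ of rank $n$ is non-extensive w.r.t. $\mathbf d$ if $\mathbf d(f(s_1,\dots,s_n),f(t_1,\dots,t_n))\le\max_{1\le i\le n}\mathbf d(s_i,t_i)$ for all $s_i,t_i\in\mathsf T(\Sigma)$. Let $\surd\in A$ denote successful termination, and let $P_{\mathrm{PA}}$ be the specification of the following operators: the stop process $0$ (no rules); the skip process $\varepsilon$ with $\varepsilon\xrightarrow{\surd}\delta(0)$; probabilistic action prefix $a.\bigoplus_{i=1}^n[p_i]\_$ ($a\in A$, $n\ge1$,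 $p_i\in(0,1]$, $\sum_ip_i=1$) with the rule $$a.\bigoplus_{i=1}^n[p_i]x_i\xrightarrow{a}\sum_{i=1}^np_i\,\delta(x_i);$$ nondeterministic alternative composition $\_+\_$ with the rules, for all $a\in A$, $$\frac{x\xrightarrow{a}\mu}{x+y\xrightarrow{a}\mu}\qquad\frac{y\xrightarrow{a}\nu}{x+y\xrightarrow{a}\nu};$$ probabilistic alternative composition $\_+_p\_$ ($p\in(0,1)$) with the rules, for all $a\in A$, $$\frac{x\xrightarrow{a}\mu\quad y\not\xrightarrow{a}}{x+_py\xrightarrow{a}\mu}\qquad\frac{x\not\xrightarrow{a}\quad y\xrightarrow{a}\nu}{x+_py\xrightarrow{a}\nu}\qquad\frac{x\xrightarrow{a}\mu\quad y\xrightarrow{a}\nu}{x+_py\xrightarrow{a}p\,\mu+(1-p)\,\nu};$$ and further the following binary operators. Sequential composition $;$ has the rules $$\frac{x\xrightarrow{a}\mu}{x;y\xrightarrow{a}\mu;\delta(y)}\ (a\ne\surd)\qquad\frac{x\xrightarrow{\surd}\mu\quad y\xrightarrow{a}\nu}{x;y\xrightarrow{a}\nu}.$$ Each parallel operator $\|'$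 among synchronous $\mid$, asynchronous $\mid\mid\mid$, probabilistic $\mid\mid\mid_p$ ($p\in(0,1)$) and CSP-like $\parallel_B$ ($B\subseteq A$) has the rule that $x\xrightarrow{\surd}\mu$ and $y\xrightarrow{\surd}\nu$ give $x\,\|'\,y\xrightarrow{\surd}\delta(0)$. The remaining rules are, for $a\neq\surd$: for $\mid$, and for $\parallel_B$ if $a\in B$, that $x\xrightarrow{a}\mu$ and $y\xrightarrow{a}\nu$ give target $\mu\,\|'\,\nu$; for $\mid\mid\mid$, and for $\parallel_B$ if $a\notin B$, that $x\xrightarrow{a}\mu$ gives target $\mu\,\|'\,\delta(y)$ and that $y\xrightarrow{a}\nu$ gives target $\delta(x)\,\|'\,\nu$; for $\mid\mid\mid_p$, that $x\xrightarrow{a}\mu$, $y\not\xrightarrow{a}$ give target $\mu\mid\mid\mid_p\delta(y)$, that $x\not\xrightarrow{a}$, $y\xrightarrow{a}\nu$ give target $\delta(x)\mid\mid\mid_p\nu$, and that $x\xrightarrow{a}\mu$, $y\xrightarrow{a}\nu$ give target $p\,(\mu\mid\mid\mid_p\delta(y))+(1-p)\,(\delta(x)\mid\mid\mid_p\nu)$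 (the conclusion being labelled $a$ in all cases). **Theorem.** Let $P=(\Sigma,A,R)$ be any PGSOS specification that is a disjoint extension of $P_{\mathrm{PA}}$, i.e. it contains the operators and rules of $P_{\mathrm{PA}}$ and has no further rules for these operators. Let $\lambda\in(0,1]$. Then the $\lambda$-bisimilarity metric $\mathbf d$ on $\mathsf T(\Sigma)$ exists, and the operators probabilistic action prefix $a.\bigoplus_{i=1}^n[p_i]\_$, nondeterministic alternative composition $\_+\_$ and probabilistic alternative composition $\_+_p\_$ are non-extensive w.r.t. $\mathbf d$: for all $s_i,t_i\in\mathsf T(\Sigma)$, $$\mathbf d\Big(a.\bigoplus_{i=1}^n[p_i]s_i,\;a.\bigoplus_{i=1}^n[p_i]t_i\Big)\le\max_{1\le i\le n}\mathbf d(s_i,t_i),$$ $$\mathbf d(s_1+s_2,\,t_1+t_2)\le\max(\mathbf d(s_1,t_1),\mathbf d(s_2,t_2)),\qquad\mathbf d(s_1+_ps_2,\,t_1+_pt_2)\le\max(\mathbf d(s_1,t_1),\mathbf d(s_2,t_2)).$$ -/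

import Mathlib

open scoped NNReal ENNReal

universe u v w

noncomputable section

/-! ### Signatures, state terms, distributions and distribution terms -/

/-- A signature: `Op n` is the set of operators of rank `n`. -/
structure Signature where
  Op : ℕ → Type u

/-- State terms over a signature `S` and a set `V` of state variables. -/
inductive Term (S : Signature.{u}) (V : Type) : Type u
  | var (x : V) : Term S V
  | op {n : ℕ} (f : S.Op n) (ts : Fin n → Term S V) : Term S V

/-- Closed state terms (processes). -/
abbrev Proc (S : Signature.{u}) : Type u := Term S Empty

/-- Simultaneous substitution of state terms for state variables. -/
def Term.subst {S : Signature.{u}} {V W : Type} (σ : V → Term S W) : Term S V → Term S W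
  | .var x => σ x
  | .op f ts => .op f (fun i => (ts i).subst σ)

/-- Product distribution on `n`-tuples; `piPMF_apply` gives the usual formula. -/
def piPMF {X : Type u} : (n : ℕ) → (Fin n → PMF X) → PMF (Fin n → X)
  | 0, _ => PMF.pure Fin.elim0
  | n + 1, π => (π 0).bind fun x => (piPMF n fun i => π i.succ).map (Fin.cons x)

theorem piPMF_apply {X : Type u} (n : ℕ) (π : Fin n → PMF X) (t : Fin n → X) :
    piPMF n π t = ∏ i, π i (t i) := by
  classical
  induction n with
  | zero => simp [piPMF, PMF.pure_apply, Subsingleton.elim t Fin.elim0]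
  | succ n ih =>
    rw [piPMF, PMF.bind_apply, tsum_eq_single (t 0), PMF.map_apply, tsum_eq_single (Fin.tail t),
      Fin.prod_univ_succ, ih]
    · simp [Fin.cons_self_tail, Fin.tail]
    · intro s hs
      rw [if_neg]
      intro h
      exact hs (by rw [h, Fin.tail_cons])
    · intro x hx
      rw [PMF.map_apply, ENNReal.tsum_eq_zero.2, mul_zero]
      intro s
      rw [if_neg]
      intro h
      exact hx (by rw [h, Fin.cons_zero])

/-- The distribution `f(π₁,…,πₙ)` on closed terms, image of the product distribution under the
operator `f`. -/
def opPMF {S : Signature.{u}} {n : ℕ} (f : S.Op n) (π : Fin n → PMF (Proc S)) : PMF (Proc S) :=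
  (piPMF n π).map (Term.op f)

/-- Distribution terms over a signature `S`, a set `V` of state variables and a set `D` of
distribution variables. Convex combinations have positive weights with sum `1`. -/
inductive DTerm (S : Signature.{u}) (V D : Type) : Type (max 1 u)
  | var (μ : D) : DTerm S V D
  | dirac (t : Term S V) : DTerm S V D
  | sum (I : Type) (p : PMF I) (hp : ∀ i, p i ≠ 0) (θ : I → DTerm S V D) : DTerm S V D
  | op {n : ℕ} (f : S.Op n) (θ : Fin n → DTerm S V D) : DTerm S V D

/-- The distribution denoted by the instance of a distribution term under the closed substitution
that sends the state variables to processes and the distribution variables to distributions. -/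
def DTerm.eval {S : Signature.{u}} {V D : Type} (σ : V → Proc S) (ρ : D → PMF (Proc S)) :
    DTerm S V D → PMF (Proc S)
  | .var μ => ρ μ
  | .dirac t => PMF.pure (t.subst σ)
  | .sum _ p _ θ => p.bind fun i => (θ i).eval σ ρ
  | .op f θ => opPMF f fun i => (θ i).eval σ ρ

/-- Translation of state terms along a rank preserving map of operators. -/
def Term.mapOp {S₁ : Signature.{u}} {S₂ : Signature.{v}} {V : Type}
    (e : ∀ n, S₁.Op n → S₂.Op n) : Term S₁ V → Term S₂ V
  | .var x => .var x
  | .op f ts => .op (e _ f) fun i => (ts i).mapOp e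

/-- Translation of distribution terms along a rank preserving map of operators. -/
def DTerm.mapOp {S₁ : Signature.{u}} {S₂ : Signature.{v}} {V D : Type}
    (e : ∀ n, S₁.Op n → S₂.Op n) : DTerm S₁ V D → DTerm S₂ V D
  | .var μ => .var μ
  | .dirac t => .dirac (t.mapOp e)
  | .sum I p hp θ => .sum I p hp fun i => (θ i).mapOp e
  | .op f θ => .op (e _ f) fun i => (θ i).mapOp e

/-! ### Probabilistic transition systems and bisimulation metrics -/

/-- A probabilistic nondeterministic labelled transition system with states `X` and actions `A`:
`M t a π` means that `t` has an `a`-labelled transition to the distribution `π`. -/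
abbrev PTS (X : Type u) (A : Type w) := X → A → PMF X → Prop

/-- `1`-bounded pseudometrics. -/
structure IsPseudometric {X : Type u} (d : X → X → ℝ≥0∞) : Prop where
  le_one : ∀ s t, d s t ≤ 1
  self : ∀ t, d t t = 0
  symm : ∀ s t, d s t = d t s
  triangle : ∀ s t r, d s t ≤ d s r + d r t

/-- Matchings of two distributions. -/
def matchings {X : Type u} (π π' : PMF X) : Set (PMF (X × X)) :=
  {ω | ω.map Prod.fst = π ∧ ω.map Prod.snd = π'}

/-- Kantorovich lifting. -/
def kantorovich {X : Type u} (d : X → X → ℝ≥0∞) (π π' : PMF X) : ℝ≥0∞ :=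
  ⨅ ω ∈ matchings π π', ∑' x : X × X, d x.1 x.2 * ω x

/-- `lam`-bisimulation metrics on a PTS. -/
structure IsBisimulationMetric {X : Type u} {A : Type w} (M : PTS X A) (lam : ℝ≥0)
    (d : X → X → ℝ≥0∞) : Prop where
  pseudometric : IsPseudometric d
  transfer : ∀ s t, d s t < 1 → ∀ a π, M s a π →
    ∃ π', M t a π' ∧ (lam : ℝ≥0∞) * kantorovich d π π' ≤ d s t

/-- The `lam`-bisimilarity metric: the infimum of all `lam`-bisimulation metrics in the pointwise
order. -/
def bisimilarityMetric {X : Type u} {A : Type w} (M : PTS X A) (lam : ℝ≥0) : X → X → ℝ≥0∞ :=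
  sInf {d | IsBisimulationMetric M lam d}

/-- Non-extensiveness of an operator with respect to a distance on processes. -/
def NonExtensive {S : Signature.{u}} (d : Proc S → Proc S → ℝ≥0∞) {n : ℕ} (f : S.Op n) : Prop :=
  ∀ s t : Fin n → Proc S, d (.op f s) (.op f t) ≤ ⨆ i, d (s i) (t i)

/-! ### PGSOS specifications -/

/-- A PGSOS rule for an operator of rank `n`. The source variables are `x₀,…,xₙ₋₁`, indexed by
`Fin n`. The `j`-th positive premise `x_i -a→ μ_j`, where `pos j = (i, a)`, has its own
distribution variable `μ_j`. The `l`-th negative premise is that `x_i` has no `b`-transition, where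
`neg l = (i, b)`. The target contains no other variables. -/
structure Rule (S : Signature.{u}) (A : Type w) (n : ℕ) where
  numPos : ℕ
  pos : Fin numPos → Fin n × A
  numNeg : ℕ
  neg : Fin numNeg → Fin n × A
  act : A
  target : DTerm S (Fin n) (Fin numPos)

/-- Translation of rules along a rank preserving map of operators. -/
def Rule.mapOp {S₁ : Signature.{u}} {S₂ : Signature.{v}} {A : Type w} {n : ℕ}
    (e : ∀ n, S₁.Op n → S₂.Op n) (r : Rule S₁ A n) : Rule S₂ A n where
  numPos := r.numPos
  pos := r.pos
  numNeg := r.numNeg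
  neg := r.neg
  act := r.act
  target := r.target.mapOp e

/-- A probabilistic transition system specification in PGSOS format with actions `A`. The set
`rules f` consists of the rules with source operator `f`. -/
structure PTSS (A : Type w) where
  sig : Signature.{u}
  rules : ∀ {n : ℕ}, sig.Op n → Set (Rule sig A n)
  finite_rules : ∀ {n : ℕ} (f : sig.Op n) (a : A), {r ∈ rules f | r.act = a}.Finite

/-- `P.Supports M t a π`: some rule of `P` has an instance with conclusion `t -a→ π` whose premises
hold in `M`. -/
def PTSS.Supports {A : Type w} (P : PTSS.{u} A) (M : PTS (Proc P.sig) A)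
    (t : Proc P.sig) (a : A) (π : PMF (Proc P.sig)) : Prop :=
  ∃ (n : ℕ) (f : P.sig.Op n), ∃ r ∈ P.rules f,
    ∃ (σ : Fin n → Proc P.sig) (ρ : Fin r.numPos → PMF (Proc P.sig)),
      (∀ j, M (σ (r.pos j).1) (r.pos j).2 (ρ j)) ∧
      (∀ l π', ¬ M (σ (r.neg l).1) (r.neg l).2 π') ∧
      t = .op f σ ∧ a = r.act ∧ π = r.target.eval σ ρ

/-- Supported models: exactly the transitions justified by the rules are present. -/
def PTSS.IsSupportedModel {A : Type w} (P : PTSS.{u} A) (M : PTS (Proc P.sig) A) : Prop :=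
  ∀ t a π, M t a π ↔ P.Supports M t a π

/-- The induced model, by recursion on the source term. It is the unique supported model, see
`PTSS.isSupportedModel_iff`. -/
def PTSS.model {A : Type w} (P : PTSS.{u} A) : PTS (Proc P.sig) A
  | .op f ts => fun a π => ∃ r ∈ P.rules f, ∃ ρ : Fin r.numPos → PMF (Proc P.sig),
      (∀ j, P.model (ts (r.pos j).1) (r.pos j).2 (ρ j)) ∧
      (∀ l π', ¬ P.model (ts (r.neg l).1) (r.neg l).2 π') ∧
      a = r.act ∧ π = r.target.eval ts ρ

theorem PTSS.isSupportedModel_iff {A : Type w} (P : PTSS.{u} A) (M : PTS (Proc P.sig) A) :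
    P.IsSupportedModel M ↔ M = P.model := by
  constructor
  · intro h
    funext t
    induction t with
    | var x => exact x.elim
    | op f ts ih =>
      funext a π
      rw [PTSS.model]
      refine propext ((h _ _ _).trans ⟨?_, ?_⟩)
      · rintro ⟨n, g, r, hr, σ, ρ, hp, hn, ht, ha, hπ⟩
        cases ht
        exact ⟨r, hr, ρ, fun j => ih _ ▸ hp j, fun l π' => ih _ ▸ hn l π', ha, hπ⟩
      · rintro ⟨r, hr, ρ, hp, hn, ha, hπ⟩
        exact ⟨_, f, r, hr, ts, ρ, fun j => (ih _).symm ▸ hp j,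
          fun l π' => (ih _).symm ▸ hn l π', rfl, ha, hπ⟩
  · rintro rfl t a π
    cases t with
    | var x => exact x.elim
    | op f ts =>
      rw [PTSS.model]
      constructor
      · rintro ⟨r, hr, ρ, hp, hn, ha, hπ⟩
        exact ⟨_, f, r, hr, ts, ρ, hp, hn, rfl, ha, hπ⟩
      · rintro ⟨n, g, r, hr, σ, ρ, hp, hn, ht, ha, hπ⟩
        cases ht
        exact ⟨r, hr, ρ, hp, hn, ha, hπ⟩

/-- `P₂` is a disjoint extension of `P₁`: the operators of `P₁` are operators of `P₂` of the same
rank, and `P₂` has for them exactly the rules of `P₁`. -/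
structure DisjointExtension {A : Type w} (P₁ : PTSS.{u} A) (P₂ : PTSS.{v} A) where
  emb : ∀ n, P₁.sig.Op n → P₂.sig.Op n
  emb_injective : ∀ n, Function.Injective (emb n)
  rules_emb : ∀ {n : ℕ} (f : P₁.sig.Op n), P₂.rules (emb n f) = Rule.mapOp emb '' P₁.rules f

/-! ### The probabilistic process algebra -/

/-- Operators of the probabilistic process algebra over the actions `A`. -/
inductive PAOp (A : Type w) : ℕ → Type w
  /-- the stop process `0` -/
  | nil : PAOp A 0
  /-- the skip process `ε` -/
  | skip : PAOp A 0
  /-- probabilistic action prefix `a.([p₁]_ ⊕ … ⊕ [pₙ]_)`; a `PMF` on `Fin n` forces `1 ≤ n` -/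
  | pre {n : ℕ} (a : A) (p : PMF (Fin n)) (hp : ∀ i, p i ≠ 0) : PAOp A n
  /-- sequential composition -/
  | seq : PAOp A 2
  /-- nondeterministic alternative composition `_ + _` -/
  | alt : PAOp A 2
  /-- probabilistic alternative composition `_ +_p _` -/
  | palt (p : Set.Ioo (0 : ℝ≥0) 1) : PAOp A 2
  /-- synchronous parallel composition `_ | _` -/
  | sync : PAOp A 2
  /-- asynchronous parallel composition `_ ||| _` -/
  | async : PAOp A 2
  /-- probabilistic parallel composition `_ |||_p _` -/
  | pasync (p : Set.Ioo (0 : ℝ≥0) 1) : PAOp A 2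
  /-- CSP-like parallel composition `_ ∥_B _` -/
  | csp (B : Set A) : PAOp A 2

/-- The signature of the probabilistic process algebra. -/
def paSig (A : Type w) : Signature.{w} := ⟨PAOp A⟩

section PA

variable {A : Type w} {V D : Type}

/-- The distribution term `f(θ₁, θ₂)` for a binary operator `f`. -/
def DTerm.bin (f : PAOp A 2) (θ₁ θ₂ : DTerm (paSig A) V D) : DTerm (paSig A) V D :=
  .op (S := paSig A) f ![θ₁, θ₂]

/-- The distribution term `δ(0)`. -/
def DTerm.deltaNil : DTerm (paSig A) V D :=
  .dirac (.op (S := paSig A) PAOp.nil Fin.elim0)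

/-- The distribution term `θ₁ ⊕_p θ₂`, with weight `p` on `θ₁` and `1 - p` on `θ₂`. -/
def DTerm.choice (p : Set.Ioo (0 : ℝ≥0) 1) (θ₁ θ₂ : DTerm (paSig A) V D) :
    DTerm (paSig A) V D :=
  .sum (Fin 2) (PMF.ofFintype ![(p.1 : ℝ≥0∞), 1 - (p.1 : ℝ≥0∞)] (by
      have h : (p.1 : ℝ≥0∞) ≤ 1 := by exact_mod_cast p.2.2.le
      simpa [Fin.sum_univ_two] using add_tsub_cancel_of_le h))
    (by
      have h0 : (p.1 : ℝ≥0∞) ≠ 0 := by exact_mod_cast p.2.1.ne'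
      have h1 : (p.1 : ℝ≥0∞) < 1 := by exact_mod_cast p.2.2
      intro i
      fin_cases i
      · simpa using h0
      · simpa using (tsub_pos_of_lt h1).ne')
    ![θ₁, θ₂]

/-- The rule of a binary operator with premise `x -a→ μ` and conclusion label `a`. -/
def ruleL (a : A) (θ : DTerm (paSig A) (Fin 2) (Fin 1)) : Rule (paSig A) A 2 :=
  ⟨1, ![(0, a)], 0, ![], a, θ⟩

/-- The rule of a binary operator with premise `y -a→ ν` and conclusion label `a`. -/
def ruleR (a : A) (θ : DTerm (paSig A) (Fin 2) (Fin 1)) : Rule (paSig A) A 2 :=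
  ⟨1, ![(1, a)], 0, ![], a, θ⟩

/-- The rule of a binary operator with premises `x -a→ μ` and `y -a↛` and conclusion label `a`. -/
def ruleLNeg (a : A) (θ : DTerm (paSig A) (Fin 2) (Fin 1)) : Rule (paSig A) A 2 :=
  ⟨1, ![(0, a)], 1, ![(1, a)], a, θ⟩

/-- The rule of a binary operator with premises `x -a↛` and `y -a→ ν` and conclusion label `a`. -/
def ruleRNeg (a : A) (θ : DTerm (paSig A) (Fin 2) (Fin 1)) : Rule (paSig A) A 2 :=
  ⟨1, ![(1, a)], 1, ![(0, a)], a, θ⟩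

/-- The rule of a binary operator with premises `x -b→ μ` and `y -a→ ν` and conclusion label `a`. -/
def ruleLR (b a : A) (θ : DTerm (paSig A) (Fin 2) (Fin 2)) : Rule (paSig A) A 2 :=
  ⟨2, ![(0, b), (1, a)], 0, ![], a, θ⟩

/-- The distribution term `δ(x)` for the source variable `x = x₀`. -/
def dx : DTerm (paSig A) (Fin 2) D := .dirac (.var 0)

/-- The distribution term `δ(y)` for the source variable `y = x₁`. -/
def dy : DTerm (paSig A) (Fin 2) D := .dirac (.var 1)

/-- The rules with conclusion label `a` of the operators of the probabilistic process algebra, where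
`tick` is the action of successful termination. In rules with one positive premise the distribution
variable is `.var 0`; in rules with two, `.var 0` belongs to `x` and `.var 1` to `y`. -/
def paRules (tick a : A) : {n : ℕ} → PAOp A n → Set (Rule (paSig A) A n)
  | _, .nil => ∅
  | _, .skip => {r | a = tick ∧ r = ⟨0, ![], 0, ![], tick, .deltaNil⟩}
  | n, .pre b p hp => {r | a = b ∧
      r = ⟨0, ![], 0, ![], b, .sum (Fin n) p hp fun i => .dirac (.var i)⟩}
  | _, .seq => {r |
      (a ≠ tick ∧ r = ruleL a (.bin .seq (.var 0) dy)) ∨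
      r = ruleLR tick a (.var 1)}
  | _, .alt => {r | r = ruleL a (.var 0) ∨ r = ruleR a (.var 0)}
  | _, .palt p => {r |
      r = ruleLNeg a (.var 0) ∨
      r = ruleRNeg a (.var 0) ∨
      r = ruleLR a a (.choice p (.var 0) (.var 1))}
  | _, .sync => {r |
      (a ≠ tick ∧ r = ruleLR a a (.bin .sync (.var 0) (.var 1))) ∨
      (a = tick ∧ r = ruleLR a a .deltaNil)}
  | _, .async => {r |
      (a ≠ tick ∧ r = ruleL a (.bin .async (.var 0) dy)) ∨
      (a ≠ tick ∧ r = ruleR a (.bin .async dx (.var 0))) ∨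
      (a = tick ∧ r = ruleLR a a .deltaNil)}
  | _, .pasync p => {r |
      (a ≠ tick ∧ r = ruleLNeg a (.bin (.pasync p) (.var 0) dy)) ∨
      (a ≠ tick ∧ r = ruleRNeg a (.bin (.pasync p) dx (.var 0))) ∨
      (a ≠ tick ∧ r = ruleLR a a
        (.choice p (.bin (.pasync p) (.var 0) dy) (.bin (.pasync p) dx (.var 1)))) ∨
      (a = tick ∧ r = ruleLR a a .deltaNil)}
  | _, .csp B => {r |
      (a ∈ B ∧ a ≠ tick ∧ r = ruleLR a a (.bin (.csp B) (.var 0) (.var 1))) ∨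
      (a = tick ∧ r = ruleLR a a .deltaNil) ∨
      (a ∉ B ∧ a ≠ tick ∧ r = ruleL a (.bin (.csp B) (.var 0) dy)) ∨
      (a ∉ B ∧ a ≠ tick ∧ r = ruleR a (.bin (.csp B) dx (.var 0)))}

theorem paRules_act (tick a : A) {n : ℕ} (f : PAOp A n) (r : Rule (paSig A) A n)
    (hr : r ∈ paRules tick a f) : r.act = a := by
  cases f <;> simp only [paRules, Set.mem_ofPred_eq, Set.mem_empty_iff_false] at hr <;>
    grind [ruleL, ruleR, ruleLNeg, ruleRNeg, ruleLR]

theorem finite_setOf_and_eq {X : Type u} (c : Prop) (x : X) : {r | c ∧ r = x}.Finite :=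
  (Set.finite_singleton x).subset fun _ h => h.2

theorem paRules_finite (tick a : A) {n : ℕ} (f : PAOp A n) : (paRules tick a f).Finite := by
  cases f <;>
    simp [paRules, Set.ofPred_or, Set.finite_union, finite_setOf_and_eq, ← and_assoc]

/-- The specification of the probabilistic process algebra. -/
def paPTSS (tick : A) : PTSS.{w} A where
  sig := paSig A
  rules f := ⋃ a, paRules tick a f
  finite_rules f a := by
    refine (paRules_finite tick a f).subset ?_
    rintro r ⟨hr, rfl⟩
    obtain ⟨b, hb⟩ := Set.mem_iUnion.1 hr
    rwa [paRules_act tick b f r hb]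

end PA

end

noncomputable section

/-! ### Expectations and disintegration of discrete distributions -/

/-! Two facts carry the proof: the bisimilarity metric is a fixed point, and the Kantorovich lifting
is convex. A process has only finitely many `a`-transitions (`PTSS.finite_model`), so the best
matching transition is attained, and bisimulation metrics are exactly the pseudometrics `d` with
`bisimulationFunctional d ≤ d` (`isBisimulationMetric_iff`). This functional is monotone and
preserves pseudometrics; its triangle inequality rests on gluing matchings. Knaster–Tarski in the
complete lattice of pseudometrics then yields the least one, which is a fixed point. Hence `d s t ≤
r` follows once `s` and `t` match each other's transitions up to `r`, measured by `d` itself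
(`bisimilarityMetric_le`). For an operator, let `r` be the largest distance between arguments. If `r
≥ 1` nothing is to be shown. Otherwise the arguments simulate each other up to `r`, and each target
is an argument's target, or a convex combination of such targets or of Dirac distributions, so
`kantorovich_bind_le` keeps the bound `r`. Negative premises transfer because arguments at distance
below `1` enable the same actions. -/

/-- The expectation of `g` under `p`. -/
def PMF.expect {α : Type u} (p : PMF α) (g : α → ℝ≥0∞) : ℝ≥0∞ := ∑' x, g x * p x

namespace PMF

variable {α : Type u} {β : Type v}

theorem expect_pure (a : α) (g : α → ℝ≥0∞) : (PMF.pure a).expect g = g a := by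
  classical
  simp [expect, PMF.pure_apply]

theorem expect_bind (p : PMF α) (f : α → PMF β) (g : β → ℝ≥0∞) :
    (p.bind f).expect g = p.expect fun x => (f x).expect g := by
  simp only [expect, PMF.bind_apply, ← ENNReal.tsum_mul_left, ← ENNReal.tsum_mul_right]
  rw [ENNReal.tsum_comm]
  exact tsum_congr fun x => tsum_congr fun y => by ring

theorem expect_map (p : PMF α) (f : α → β) (g : β → ℝ≥0∞) :
    (p.map f).expect g = p.expect (g ∘ f) := by
  rw [← PMF.bind_pure_comp, expect_bind]
  congr 1
  funext x
  exact expect_pure _ _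

theorem expect_mono (p : PMF α) {g g' : α → ℝ≥0∞} (h : ∀ x ∈ p.support, g x ≤ g' x) :
    p.expect g ≤ p.expect g' := by
  refine ENNReal.tsum_le_tsum fun x => ?_
  by_cases hx : p x = 0
  · simp [hx]
  · exact mul_le_mul_left (h x ((p.mem_support_iff x).2 hx)) _

theorem expect_add (p : PMF α) (g g' : α → ℝ≥0∞) :
    (p.expect fun x => g x + g' x) = p.expect g + p.expect g' := by
  simp only [expect, add_mul]
  exact ENNReal.tsum_add

theorem expect_const (p : PMF α) (c : ℝ≥0∞) : (p.expect fun _ => c) = c := by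
  simp [expect, ENNReal.tsum_mul_left, p.tsum_coe]

/-- The kernel `k y` is `p` conditioned on the fibre of `h` over `y`. -/
theorem exists_disintegration (p : PMF α) (h : α → β) :
    ∃ k : β → PMF α, (p.map h).bind k = p ∧
      ∀ y ∈ (p.map h).support, ∀ x ∈ (k y).support, h x = y := by
  classical
  have hsup : ∀ y, y ∈ (p.map h).support → ∃ a ∈ h ⁻¹' {y}, a ∈ p.support := by
    intro y hy
    obtain ⟨a, ha, rfl⟩ := (PMF.mem_support_map_iff _ _ _).1 hy
    exact ⟨a, rfl, ha⟩
  -- Fibres of mass zero cannot be conditioned on; the value `p` there is arbitrary, since it gets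
  -- weight zero.
  let k : β → PMF α := fun y =>
    if hy : y ∈ (p.map h).support then p.filter (h ⁻¹' {y}) (hsup y hy) else p
  have hk : ∀ y (hy : y ∈ (p.map h).support), k y = p.filter (h ⁻¹' {y}) (hsup y hy) :=
    fun y hy => dif_pos hy
  have hfib : ∀ y ∈ (p.map h).support, ∀ x ∈ (k y).support, h x = y := by
    intro y hy x hx
    rw [hk y hy, PMF.mem_support_filter_iff] at hx
    exact hx.1
  refine ⟨k, ?_, hfib⟩
  ext a
  rw [PMF.bind_apply, tsum_eq_single (h a)]
  · by_cases ha : h a ∈ (p.map h).support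
    -- The normalising constant of the conditioned distribution is the mass of the fibre, so it
    -- cancels against the weight in the `bind`.
    · have hZ : (p.map h) (h a) = ∑' x, (h ⁻¹' {h a}).indicator p x := by
        rw [PMF.map_apply]
        exact tsum_congr fun x => by simp [Set.indicator_apply, eq_comm]
      rw [hk _ ha, PMF.filter_apply, ← hZ, Set.indicator_of_mem (by simp), mul_left_comm,
        ENNReal.mul_inv_cancel ((PMF.mem_support_iff _ _).1 ha) (PMF.apply_ne_top _ _), mul_one]
    · have ha' : p a = 0 := by
        by_contra h0
        exact ha ((PMF.mem_support_map_iff _ _ _).2 ⟨a, (p.mem_support_iff a).2 h0, rfl⟩)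
      rw [(PMF.apply_eq_zero_iff _ _).2 ha, ha', zero_mul]
  · intro y hy
    by_contra h0
    obtain ⟨h1, h2⟩ := mul_ne_zero_iff.1 h0
    exact hy (hfib y ((PMF.mem_support_iff _ _).2 h1) a ((PMF.mem_support_iff _ _).2 h2)).symm

end PMF

/-! ### The Kantorovich lifting -/

section Kantorovich

variable {X : Type u} {d d' : X → X → ℝ≥0∞}

theorem kantorovich_le_expect {π π' : PMF X} {ω : PMF (X × X)} (hω : ω ∈ matchings π π') :
    kantorovich d π π' ≤ ω.expect fun x => d x.1 x.2 :=
  iInf₂_le ω hω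

theorem exists_matching_of_kantorovich_lt {π π' : PMF X} {r : ℝ≥0∞}
    (h : kantorovich d π π' < r) :
    ∃ ω ∈ matchings π π', (ω.expect fun x => d x.1 x.2) < r := by
  obtain ⟨ω, h⟩ := iInf_lt_iff.1 h
  obtain ⟨hω, h⟩ := iInf_lt_iff.1 h
  exact ⟨ω, hω, h⟩

theorem kantorovich_mono (h : d ≤ d') (π π' : PMF X) :
    kantorovich d π π' ≤ kantorovich d' π π' :=
  iInf₂_mono fun _ _ => ENNReal.tsum_le_tsum fun x => mul_le_mul_left (h x.1 x.2) _

theorem kantorovich_self (hd : ∀ x, d x x = 0) (π : PMF X) : kantorovich d π π = 0 := by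
  have hω : π.map (fun x => (x, x)) ∈ matchings π π := by
    constructor <;> rw [PMF.map_comp] <;> exact PMF.map_id π
  refine le_antisymm ((kantorovich_le_expect hω).trans ?_) zero_le
  rw [PMF.expect_map]
  simp [PMF.expect, hd]

/-- Matchings can be composed along a common marginal. -/
theorem exists_glued_matching (hd : ∀ x y z, d x y ≤ d x z + d z y) {π₁ π₂ π₃ : PMF X}
    {ω ω' : PMF (X × X)} (hω : ω ∈ matchings π₁ π₂) (hω' : ω' ∈ matchings π₂ π₃) :
    ∃ τ ∈ matchings π₁ π₃, (τ.expect fun x => d x.1 x.2) ≤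
      (ω.expect fun x => d x.1 x.2) + ω'.expect fun x => d x.1 x.2 := by
  obtain ⟨k, hk, hks⟩ := ω.exists_disintegration Prod.snd
  obtain ⟨k', hk', hks'⟩ := ω'.exists_disintegration Prod.fst
  rw [hω.2] at hk hks
  rw [hω'.1] at hk' hks'
  -- Draw the middle point `y` from the common marginal, then draw pairs `u` and `v` independently
  -- from the two matchings conditioned on `y`, and keep the outer ends.
  refine ⟨π₂.bind fun y => (k y).bind fun u => (k' y).map fun v => (u.1, v.2), ⟨?_, ?_⟩, ?_⟩
  · rw [← hω.1, ← hk]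
    simp only [PMF.map_bind, PMF.map_comp]
    congr 1
    funext y
    rw [← PMF.bind_pure_comp]
    congr 1
    funext u
    exact PMF.map_const _ _
  · rw [← hω'.2, ← hk']
    simp only [PMF.map_bind, PMF.map_comp]
    congr 1
    funext y
    exact PMF.bind_const (k y) ((k' y).map Prod.snd)
  · calc _ = π₂.expect fun y => (k y).expect fun u => (k' y).expect fun v => d u.1 v.2 := by
          simp only [PMF.expect_bind, PMF.expect_map]
          rfl
      _ ≤ π₂.expect fun y => (k y).expect fun u => (k' y).expect fun v =>
            d u.1 u.2 + d v.1 v.2 := by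
          -- On the supports `u.2 = y = v.1`, so the triangle inequality through `y` applies.
          refine PMF.expect_mono _ fun y hy => PMF.expect_mono _ fun u hu =>
            PMF.expect_mono _ fun v hv => ?_
          rw [hks y hy u hu, hks' y hy v hv]
          exact hd _ _ _
      _ = _ := by
          simp only [PMF.expect_add, PMF.expect_const]
          rw [← PMF.expect_bind, ← PMF.expect_bind, hk, hk']

theorem kantorovich_triangle (hd : ∀ x y z, d x y ≤ d x z + d z y) (π₁ π₂ π₃ : PMF X) :
    kantorovich d π₁ π₃ ≤ kantorovich d π₁ π₂ + kantorovich d π₂ π₃ := by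
  refine ENNReal.le_iInf₂_add_iInf₂ fun ω hω ω' hω' => ?_
  obtain ⟨τ, hτ, h⟩ := exists_glued_matching hd hω hω'
  exact (kantorovich_le_expect hτ).trans h

theorem kantorovich_pure_le (x y : X) : kantorovich d (PMF.pure x) (PMF.pure y) ≤ d x y := by
  have hω : PMF.pure (x, y) ∈ matchings (PMF.pure x) (PMF.pure y) :=
    ⟨PMF.pure_map _ _, PMF.pure_map _ _⟩
  exact (kantorovich_le_expect hω).trans (PMF.expect_pure _ _).le

/-- Mixing matchings of the components with the weights `p` gives a matching of the mixtures.
Passing to an arbitrary `r' > r` avoids the need for optimal matchings. -/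
theorem kantorovich_bind_le {I : Type v} (p : PMF I) {μ ν : I → PMF X} {r : ℝ≥0∞}
    (h : ∀ i, kantorovich d (μ i) (ν i) ≤ r) :
    kantorovich d (p.bind μ) (p.bind ν) ≤ r := by
  refine le_of_forall_gt_imp_ge_of_dense fun r' hr' => ?_
  choose ω hω hc using fun i => exists_matching_of_kantorovich_lt ((h i).trans_lt hr')
  have hb : p.bind ω ∈ matchings (p.bind μ) (p.bind ν) := by
    constructor
    · rw [PMF.map_bind]
      exact congrArg p.bind (funext fun i => (hω i).1)
    · rw [PMF.map_bind]
      exact congrArg p.bind (funext fun i => (hω i).2)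
  refine (kantorovich_le_expect hb).trans ?_
  rw [PMF.expect_bind, ← PMF.expect_const p r']
  exact PMF.expect_mono _ fun i _ => (hc i).le

end Kantorovich

/-! ### The bisimilarity metric of an image-finite system -/

section Bisimilarity

variable {X : Type u} {A : Type w} (M : PTS X A) (lam : ℝ≥0)

/-- Every transition of `s` is matched by one of `t` up to the discounted distance `r`. -/
def SimulatesUpTo (d : X → X → ℝ≥0∞) (r : ℝ≥0∞) (s t : X) : Prop :=
  ∀ a π, M s a π → ∃ π', M t a π' ∧ (lam : ℝ≥0∞) * kantorovich d π π' ≤ r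

/-- The bisimulation functional: the least `r ≤ 1` up to which `s` and `t` simulate each other, and
`1` if there is none. -/
def bisimulationFunctional (d : X → X → ℝ≥0∞) (s t : X) : ℝ≥0∞ :=
  min 1 (sInf {r | SimulatesUpTo M lam d r s t ∧ SimulatesUpTo M lam d r t s})

variable {M lam} {d d' : X → X → ℝ≥0∞}

theorem SimulatesUpTo.mono {r r' : ℝ≥0∞} {s t : X} (h : SimulatesUpTo M lam d r s t)
    (hd : d' ≤ d) (hr : r ≤ r') : SimulatesUpTo M lam d' r' s t := by
  intro a π hπ
  obtain ⟨π', hπ', hK⟩ := h a π hπ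
  exact ⟨π', hπ', (mul_le_mul_right (kantorovich_mono hd _ _) _).trans (hK.trans hr)⟩

theorem SimulatesUpTo.trans (hd : IsPseudometric d) {r r' : ℝ≥0∞} {s t q : X}
    (h : SimulatesUpTo M lam d r s q) (h' : SimulatesUpTo M lam d r' q t) :
    SimulatesUpTo M lam d (r + r') s t := by
  intro a π hπ
  obtain ⟨π', hπ', hK⟩ := h a π hπ
  obtain ⟨π'', hπ'', hK'⟩ := h' a π' hπ'
  refine ⟨π'', hπ'', (mul_le_mul_right (kantorovich_triangle hd.triangle π π' π'') _).trans ?_⟩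
  rw [mul_add]
  exact add_le_add hK hK'

theorem SimulatesUpTo.refl (hd : IsPseudometric d) (s : X) : SimulatesUpTo M lam d 0 s s :=
  fun _ π hπ => ⟨π, hπ, by simp [kantorovich_self hd.self]⟩

/-- Image-finiteness enters here: among the finitely many answers to a transition, one of least
Kantorovich distance works for every `r ∈ R` at once. An element of `R` ensures that some answer
exists. -/
theorem SimulatesUpTo.sInf (hM : ∀ t a, {π | M t a π}.Finite) {R : Set ℝ≥0∞} (hR : R.Nonempty)
    {s t : X} (h : ∀ r ∈ R, SimulatesUpTo M lam d r s t) :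
    SimulatesUpTo M lam d (sInf R) s t := by
  intro a π hπ
  obtain ⟨r₀, hr₀⟩ := hR
  obtain ⟨π₀, hπ₀, -⟩ := h r₀ hr₀ a π hπ
  obtain ⟨π₁, hπ₁, hmin⟩ := Set.exists_min_image {π' | M t a π'}
    (fun π' => (lam : ℝ≥0∞) * kantorovich d π π') (hM t a) ⟨π₀, hπ₀⟩
  refine ⟨π₁, hπ₁, le_sInf fun r hr => ?_⟩
  obtain ⟨π', hπ', hK⟩ := h r hr a π hπ
  exact (hmin π' hπ').trans hK

theorem bisimulationFunctional_le_one (s t : X) : bisimulationFunctional M lam d s t ≤ 1 :=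
  min_le_left _ _

theorem bisimulationFunctional_le {r : ℝ≥0∞} {s t : X} (h : SimulatesUpTo M lam d r s t)
    (h' : SimulatesUpTo M lam d r t s) : bisimulationFunctional M lam d s t ≤ r :=
  (min_le_right _ _).trans (sInf_le ⟨h, h'⟩)

theorem bisimulationFunctional_symm (s t : X) :
    bisimulationFunctional M lam d s t = bisimulationFunctional M lam d t s := by
  simp only [bisimulationFunctional, and_comm]

theorem bisimulationFunctional_mono (h : d ≤ d') :
    bisimulationFunctional M lam d ≤ bisimulationFunctional M lam d' := fun _ _ =>
  min_le_min_left _ (sInf_le_sInf fun _ hr => ⟨hr.1.mono h le_rfl, hr.2.mono h le_rfl⟩)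

theorem simulatesUpTo_bisimulationFunctional (hM : ∀ t a, {π | M t a π}.Finite) {s t : X}
    (h : bisimulationFunctional M lam d s t < 1) :
    SimulatesUpTo M lam d (bisimulationFunctional M lam d s t) s t := by
  have h' := (min_lt_iff.1 h).resolve_left (lt_irrefl _)
  obtain ⟨r, hr, -⟩ := sInf_lt_iff.1 h'
  rw [bisimulationFunctional, min_eq_right h'.le]
  exact .sInf hM ⟨r, hr⟩ fun r hr => hr.1

theorem isPseudometric_bisimulationFunctional (hM : ∀ t a, {π | M t a π}.Finite)
    (hd : IsPseudometric d) : IsPseudometric (bisimulationFunctional M lam d) where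
  le_one := bisimulationFunctional_le_one
  self t := le_antisymm (bisimulationFunctional_le (.refl hd t) (.refl hd t)) zero_le
  symm := bisimulationFunctional_symm
  triangle s t q := by
    rcases lt_or_ge (bisimulationFunctional M lam d s q) 1 with h | h
    · rcases lt_or_ge (bisimulationFunctional M lam d q t) 1 with h' | h'
      · refine bisimulationFunctional_le ((simulatesUpTo_bisimulationFunctional hM h).trans hd
          (simulatesUpTo_bisimulationFunctional hM h')) ?_
        -- The converse simulation runs from `t` through `q` to `s`, so the distances are reversed
        -- and the sum commuted.
        rw [bisimulationFunctional_symm s q, bisimulationFunctional_symm q t] at *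
        rw [add_comm]
        exact (simulatesUpTo_bisimulationFunctional hM h').trans hd
          (simulatesUpTo_bisimulationFunctional hM h)
      · exact (bisimulationFunctional_le_one s t).trans (h'.trans le_add_self)
    · exact (bisimulationFunctional_le_one s t).trans (h.trans le_self_add)

theorem IsBisimulationMetric.simulatesUpTo (hd : IsBisimulationMetric M lam d) {s t : X}
    {r : ℝ≥0∞} (h : d s t ≤ r) (hr : r < 1) : SimulatesUpTo M lam d r s t :=
  SimulatesUpTo.mono (hd.transfer s t (h.trans_lt hr)) le_rfl h

/-- The transfer condition is vacuous at distance `1`, which matches the cap in the functional.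
Symmetry of `d` supplies the simulation in the other direction, and attainment of the infimum gives
the converse. -/
theorem isBisimulationMetric_iff (hM : ∀ t a, {π | M t a π}.Finite) (hd : IsPseudometric d) :
    IsBisimulationMetric M lam d ↔ bisimulationFunctional M lam d ≤ d := by
  constructor
  · intro h s t
    rcases lt_or_ge (d s t) 1 with h1 | h1
    · exact bisimulationFunctional_le (h.simulatesUpTo le_rfl h1)
        (h.simulatesUpTo (hd.symm t s).le h1)
    · exact (bisimulationFunctional_le_one s t).trans h1
  · exact fun h => ⟨hd, fun s t hst =>
      (simulatesUpTo_bisimulationFunctional hM ((h s t).trans_lt hst)).mono le_rfl (h s t)⟩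

theorem isPseudometric_sSup {D : Set (X → X → ℝ≥0∞)} (hD : ∀ d ∈ D, IsPseudometric d) :
    IsPseudometric (sSup D) := by
  have hle : ∀ e ∈ D, ∀ s t, e s t ≤ sSup D s t := fun e he s t => le_sSup he s t
  have hlub : ∀ s t c, (∀ e ∈ D, e s t ≤ c) → sSup D s t ≤ c := by
    intro s t c h
    rw [sSup_apply, iSup_apply]
    exact iSup_le fun e => h e e.2
  have hsymm : ∀ s t, sSup D s t ≤ sSup D t s := fun s t =>
    hlub _ _ _ fun e he => ((hD e he).symm s t).le.trans (hle e he t s)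
  exact
    { le_one := fun s t => hlub _ _ _ fun e he => (hD e he).le_one s t
      self := fun t => le_antisymm (hlub _ _ _ fun e he => ((hD e he).self t).le) zero_le
      symm := fun s t => le_antisymm (hsymm s t) (hsymm t s)
      triangle := fun s t q => hlub _ _ _ fun e he =>
        ((hD e he).triangle s t q).trans (add_le_add (hle e he s q) (hle e he q t)) }

/-- Knaster–Tarski for pseudometrics. A pointwise infimum of pseudometrics may violate the triangle
inequality, so the meet is formed as the supremum `m` of all pseudometrics below every bisimulation
metric; once `m` is seen to be the least one, it coincides with the pointwise infimum. -/
theorem isLeast_bisimilarityMetric (hM : ∀ t a, {π | M t a π}.Finite) :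
    IsLeast {d | IsBisimulationMetric M lam d} (bisimilarityMetric M lam) := by
  let m : X → X → ℝ≥0∞ :=
    sSup {e | IsPseudometric e ∧ ∀ d, IsBisimulationMetric M lam d → e ≤ d}
  have hm : IsPseudometric m := isPseudometric_sSup fun e he => he.1
  have hmle : ∀ d, IsBisimulationMetric M lam d → m ≤ d :=
    fun d hd => sSup_le fun e he => he.2 d hd
  have hleast : IsLeast {d | IsBisimulationMetric M lam d} m := by
    -- The functional applied to `m` is again a pseudometric below every bisimulation metric, hence
    -- below `m`.
    refine ⟨(isBisimulationMetric_iff hM hm).2 (le_sSup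
      ⟨isPseudometric_bisimulationFunctional hM hm, fun d hd => ?_⟩), fun d hd => hmle d hd⟩
    exact (bisimulationFunctional_mono (hmle d hd)).trans
      ((isBisimulationMetric_iff hM hd.pseudometric).1 hd)
  rw [bisimilarityMetric, hleast.isGLB.sInf_eq]
  exact hleast

/-- By monotonicity, applying the functional to the least prefixed point gives another prefixed
point; leastness makes it a postfixed point too. -/
theorem bisimilarityMetric_le (hM : ∀ t a, {π | M t a π}.Finite) {r : ℝ≥0∞} {s t : X}
    (h : SimulatesUpTo M lam (bisimilarityMetric M lam) r s t)
    (h' : SimulatesUpTo M lam (bisimilarityMetric M lam) r t s) :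
    bisimilarityMetric M lam s t ≤ r := by
  have hl := isLeast_bisimilarityMetric (lam := lam) hM
  have hd : IsPseudometric (bisimilarityMetric M lam) := hl.1.pseudometric
  have hpre := (isBisimulationMetric_iff hM hd).1 hl.1
  have hpost := hl.2 ((isBisimulationMetric_iff hM
    (isPseudometric_bisimulationFunctional hM hd)).2 (bisimulationFunctional_mono hpre))
  exact (hpost s t).trans (bisimulationFunctional_le h h')

end Bisimilarity

/-! ### Transitions of processes -/

/-- By structural induction: finitely many rules have the given operator and label, and each has
finitely many premises with finitely many solutions. -/
theorem PTSS.finite_model {A : Type w} (P : PTSS.{u} A) (t : Proc P.sig) (a : A) :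
    {π | P.model t a π}.Finite := by
  induction t generalizing a with
  | var x => exact x.elim
  | op f ts ih =>
    refine ((P.finite_rules f a).biUnion fun r _ =>
      (Set.Finite.pi fun j => ih (r.pos j).1 (r.pos j).2).image (r.target.eval ts)).subset ?_
    intro π hπ
    rw [Set.mem_ofPred_eq, PTSS.model] at hπ
    obtain ⟨r, hr, ρ, hp, -, ha, rfl⟩ := hπ
    exact Set.mem_biUnion (show r ∈ {r ∈ P.rules f | r.act = a} from ⟨hr, ha.symm⟩)
      ⟨ρ, fun j _ => hp j, rfl⟩

/-- The distribution on `Fin 2` with weights `p` and `1 - p`. -/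
def weightPMF (p : Set.Ioo (0 : ℝ≥0) 1) : PMF (Fin 2) :=
  PMF.ofFintype ![(p.1 : ℝ≥0∞), 1 - (p.1 : ℝ≥0∞)] (by
    have h : (p.1 : ℝ≥0∞) ≤ 1 := by exact_mod_cast p.2.2.le
    simpa [Fin.sum_univ_two] using add_tsub_cancel_of_le h)

namespace DisjointExtension

variable {A : Type w} {tick : A} {P : PTSS.{u} A} (E : DisjointExtension (paPTSS tick) P)

/-- Disjointness of the extension excludes further rules for `f`, and the conclusion label selects
one member of the family `paRules tick a f`. -/
theorem model_emb_iff {n : ℕ} (f : PAOp A n) (ts : Fin n → Proc P.sig) (a : A)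
    (π : PMF (Proc P.sig)) :
    P.model (.op (E.emb n f) ts) a π ↔ ∃ r ∈ paRules tick a f,
      ∃ ρ : Fin r.numPos → PMF (Proc P.sig),
        (∀ j, P.model (ts (r.pos j).1) (r.pos j).2 (ρ j)) ∧
        (∀ l π', ¬ P.model (ts (r.neg l).1) (r.neg l).2 π') ∧
        π = (r.target.mapOp E.emb).eval ts ρ := by
  rw [PTSS.model, E.rules_emb (n := n) f]
  constructor
  · rintro ⟨_, ⟨r, hr, rfl⟩, ρ, hp, hn, ha, hπ⟩
    obtain ⟨b, hb⟩ := Set.mem_iUnion.1 hr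
    have hab : a = b := ha.trans (paRules_act tick b f r hb)
    subst hab
    exact ⟨r, hb, ρ, hp, hn, hπ⟩
  · rintro ⟨r, hr, ρ, hp, hn, hπ⟩
    exact ⟨_, ⟨r, Set.mem_iUnion.2 ⟨a, hr⟩, rfl⟩, ρ, hp, hn, (paRules_act tick a f r hr).symm, hπ⟩

theorem model_pre_iff {n : ℕ} (b : A) (p : PMF (Fin n)) (hp : ∀ i, p i ≠ 0)
    (ts : Fin n → Proc P.sig) (a : A) (π : PMF (Proc P.sig)) :
    P.model (.op (E.emb n (.pre b p hp)) ts) a π ↔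
      a = b ∧ π = p.bind fun i => PMF.pure (ts i) := by
  rw [E.model_emb_iff]
  constructor
  · rintro ⟨r, ⟨rfl, rfl⟩, ρ, -, -, hπ⟩
    exact ⟨rfl, hπ⟩
  · rintro ⟨rfl, hπ⟩
    exact ⟨_, ⟨rfl, rfl⟩, Fin.elim0, fun j => j.elim0, fun l => l.elim0, hπ⟩

theorem model_alt_iff (ts : Fin 2 → Proc P.sig) (a : A) (π : PMF (Proc P.sig)) :
    P.model (.op (E.emb 2 .alt) ts) a π ↔ P.model (ts 0) a π ∨ P.model (ts 1) a π := by
  rw [E.model_emb_iff]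
  constructor
  · rintro ⟨r, rfl | rfl, ρ, hp, -, rfl⟩
    · exact Or.inl (hp (0 : Fin 1))
    · exact Or.inr (hp (0 : Fin 1))
  · rintro (h | h)
    · exact ⟨_, Or.inl rfl, fun _ => π, Fin.forall_fin_one.2 h, fun l => l.elim0, rfl⟩
    · exact ⟨_, Or.inr rfl, fun _ => π, Fin.forall_fin_one.2 h, fun l => l.elim0, rfl⟩

theorem model_palt_iff (p : Set.Ioo (0 : ℝ≥0) 1) (ts : Fin 2 → Proc P.sig) (a : A)
    (π : PMF (Proc P.sig)) :
    P.model (.op (E.emb 2 (.palt p)) ts) a π ↔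
      (P.model (ts 0) a π ∧ ∀ ν, ¬ P.model (ts 1) a ν) ∨
      ((∀ μ, ¬ P.model (ts 0) a μ) ∧ P.model (ts 1) a π) ∨
      ∃ ρ : Fin 2 → PMF (Proc P.sig), (∀ i, P.model (ts i) a (ρ i)) ∧
        π = (weightPMF p).bind ρ := by
  have heval : ∀ ρ : Fin 2 → PMF (Proc P.sig),
      ((DTerm.choice p (.var 0) (.var 1) : DTerm (paSig A) (Fin 2) (Fin 2)).mapOp E.emb).eval ts ρ
        = (weightPMF p).bind ρ := by
    intro ρ
    refine congrArg (weightPMF p).bind (funext fun i => ?_)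
    fin_cases i <;> rfl
  rw [E.model_emb_iff]
  constructor
  · rintro ⟨r, rfl | rfl | rfl, ρ, hp, hn, rfl⟩
    · exact Or.inl ⟨hp (0 : Fin 1), hn (0 : Fin 1)⟩
    · exact Or.inr (Or.inl ⟨hn (0 : Fin 1), hp (0 : Fin 1)⟩)
    · exact Or.inr (Or.inr ⟨ρ, Fin.forall_fin_two.2 ⟨hp (0 : Fin 2), hp (1 : Fin 2)⟩, heval ρ⟩)
  · rintro (⟨h, h'⟩ | ⟨h, h'⟩ | ⟨ρ, h, rfl⟩)
    · exact ⟨_, Or.inl rfl, fun _ => π, Fin.forall_fin_one.2 h, Fin.forall_fin_one.2 h', rfl⟩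
    · exact ⟨_, Or.inr (Or.inl rfl), fun _ => π, Fin.forall_fin_one.2 h', Fin.forall_fin_one.2 h,
        rfl⟩
    · exact ⟨_, Or.inr (Or.inr rfl), ρ, Fin.forall_fin_two.2 ⟨h 0, h 1⟩, fun l => l.elim0,
        (heval ρ).symm⟩

/-! ### Non-extensiveness -/

variable {lam : ℝ≥0} {d : Proc P.sig → Proc P.sig → ℝ≥0∞} {r : ℝ≥0∞}

theorem simulatesUpTo_pre (hlam : lam ≤ 1) {n : ℕ} (b : A) (p : PMF (Fin n))
    (hp : ∀ i, p i ≠ 0) {s t : Fin n → Proc P.sig} (h : ∀ i, d (s i) (t i) ≤ r) :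
    SimulatesUpTo P.model lam d r (.op (E.emb n (.pre b p hp)) s)
      (.op (E.emb n (.pre b p hp)) t) := by
  intro a π hπ
  obtain ⟨rfl, rfl⟩ := (E.model_pre_iff b p hp s a π).1 hπ
  refine ⟨_, (E.model_pre_iff _ p hp t _ _).2 ⟨rfl, rfl⟩, ?_⟩
  -- The discount is at most `1` and can be dropped; the rest is convexity over Dirac distributions.
  exact (mul_le_of_le_one_left zero_le (by exact_mod_cast hlam)).trans
    (kantorovich_bind_le p fun i => (kantorovich_pure_le _ _).trans (h i))

theorem simulatesUpTo_alt {s t : Fin 2 → Proc P.sig}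
    (h : ∀ i, SimulatesUpTo P.model lam d r (s i) (t i)) :
    SimulatesUpTo P.model lam d r (.op (E.emb 2 .alt) s) (.op (E.emb 2 .alt) t) := by
  intro a π hπ
  rcases (E.model_alt_iff s a π).1 hπ with hπ | hπ
  · obtain ⟨π', hπ', hK⟩ := h 0 a π hπ
    exact ⟨π', (E.model_alt_iff t a π').2 (Or.inl hπ'), hK⟩
  · obtain ⟨π', hπ', hK⟩ := h 1 a π hπ
    exact ⟨π', (E.model_alt_iff t a π').2 (Or.inr hπ'), hK⟩

theorem simulatesUpTo_palt (hlam : lam ≠ 0) (p : Set.Ioo (0 : ℝ≥0) 1)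
    {s t : Fin 2 → Proc P.sig} (h : ∀ i, SimulatesUpTo P.model lam d r (s i) (t i))
    (h' : ∀ i, SimulatesUpTo P.model lam d r (t i) (s i)) :
    SimulatesUpTo P.model lam d r (.op (E.emb 2 (.palt p)) s) (.op (E.emb 2 (.palt p)) t) := by
  -- Negative premises need the reverse simulation: an action enabled in `t i` is enabled in `s i`.
  have hneg : ∀ i a, (∀ ν, ¬ P.model (s i) a ν) → ∀ ν, ¬ P.model (t i) a ν := by
    intro i a hs ν hν
    obtain ⟨ν', hν', -⟩ := h' i a ν hν
    exact hs ν' hν'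
  intro a π hπ
  rcases (E.model_palt_iff p s a π).1 hπ with ⟨hπ, hn⟩ | ⟨hn, hπ⟩ | ⟨ρ, hρ, rfl⟩
  · obtain ⟨π', hπ', hK⟩ := h 0 a π hπ
    exact ⟨π', (E.model_palt_iff p t a π').2 (Or.inl ⟨hπ', hneg 1 a hn⟩), hK⟩
  · obtain ⟨π', hπ', hK⟩ := h 1 a π hπ
    exact ⟨π', (E.model_palt_iff p t a π').2 (Or.inr (Or.inl ⟨hneg 0 a hn, hπ'⟩)), hK⟩
  · choose ρ' hρ' hK using fun i => h i a (ρ i) (hρ i)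
    refine ⟨_, (E.model_palt_iff p t a _).2 (Or.inr (Or.inr ⟨ρ', hρ', rfl⟩)), ?_⟩
    have h0 : (lam : ℝ≥0∞) ≠ 0 := by exact_mod_cast hlam
    -- The discount is moved to the other side, so that convexity applies with the uniform bound `r
    -- / lam`.
    rw [mul_comm, ← ENNReal.le_div_iff_mul_le (Or.inl h0) (Or.inl ENNReal.coe_ne_top)]
    refine kantorovich_bind_le _ fun i => ?_
    rw [ENNReal.le_div_iff_mul_le (Or.inl h0) (Or.inl ENNReal.coe_ne_top), mul_comm]
    exact hK i

end DisjointExtension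

/-- An operator is non-extensive if it preserves mutual simulation up to every `r < 1`. -/
theorem nonExtensive_of_simulatesUpTo {A : Type w} {P : PTSS.{u} A} {lam : ℝ≥0} {n : ℕ}
    {f : P.sig.Op n}
    (h : ∀ (r : ℝ≥0∞) (s t : Fin n → Proc P.sig), r < 1 →
      (∀ i, bisimilarityMetric P.model lam (s i) (t i) ≤ r) →
      (∀ i, bisimilarityMetric P.model lam (t i) (s i) ≤ r) →
      SimulatesUpTo P.model lam (bisimilarityMetric P.model lam) r (.op f s) (.op f t)) :
    NonExtensive (bisimilarityMetric P.model lam) f := by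
  intro s t
  have hd := (isLeast_bisimilarityMetric (lam := lam) P.finite_model).1
  have h₁ : ∀ i, bisimilarityMetric P.model lam (s i) (t i) ≤
      ⨆ i, bisimilarityMetric P.model lam (s i) (t i) := le_iSup _
  have h₂ := fun i => (hd.pseudometric.symm (t i) (s i)).le.trans (h₁ i)
  rcases lt_or_ge (⨆ i, bisimilarityMetric P.model lam (s i) (t i)) 1 with hr | hr
  -- The hypotheses are symmetric in `s` and `t`, so `h` yields both directions.
  · exact bisimilarityMetric_le P.finite_model (h _ s t hr h₁ h₂) (h _ t s hr h₂ h₁)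
  · exact (hd.pseudometric.le_one _ _).trans hr

end

theorem mainTheorem6 {A : Type w} (tick : A) (P : PTSS.{u} A)
    (E : DisjointExtension (paPTSS tick) P) (lam : ℝ≥0) (hlam₀ : 0 < lam) (hlam₁ : lam ≤ 1) :
    IsLeast {d | IsBisimulationMetric P.model lam d} (bisimilarityMetric P.model lam) ∧
    (∀ (n : ℕ) (a : A) (p : PMF (Fin n)) (hp : ∀ i, p i ≠ 0),
      NonExtensive (bisimilarityMetric P.model lam) (E.emb n (PAOp.pre a p hp))) ∧
    NonExtensive (bisimilarityMetric P.model lam) (E.emb 2 PAOp.alt) ∧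
    (∀ p : Set.Ioo (0 : ℝ≥0) 1,
      NonExtensive (bisimilarityMetric P.model lam) (E.emb 2 (PAOp.palt p))) := by
  have hl := isLeast_bisimilarityMetric (lam := lam) P.finite_model
  refine ⟨hl, fun n a p hp => nonExtensive_of_simulatesUpTo fun r s t _ h _ =>
      E.simulatesUpTo_pre hlam₁ a p hp h,
    nonExtensive_of_simulatesUpTo fun r s t hr h _ =>
      E.simulatesUpTo_alt fun i => hl.1.simulatesUpTo (h i) hr,
    fun p => nonExtensive_of_simulatesUpTo fun r s t hr h h' =>
      E.simulatesUpTo_palt hlam₀.ne' p (fun i => hl.1.simulatesUpTo (h i) hr)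
        fun i => hl.1.simulatesUpTo (h' i) hr⟩
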